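/- Let $G$ be a group, $H\le G$ a subgroup of finite index $m$ and $f:H\to G$ a homomorphism; the data $(G,H,f)$ is called a triple of degree $m$. The $f$-core of $H$ is the largest subgroup $K\le H$ that is normal in $G$ and satisfies $f(K)\le K$, and the triple is simple if the $f$-core of $H$ is trivial. Let $p$ be a prime number. If $G$ is a finitely generated nilpotent group, $[G:H]=p$ and $(G,H,f)$ is a simple triple, then $G$ is either a finite $p$-group or a free abelian group. In the finite case there is no restriction on the nilpotency class or on the derived length: for every $n$ there is a simple triple $(G,H,f)$ of degree $p$ in which $G$ is a finite $p$-group of nilpotency class at least $n$ and derived length at least $n$. -/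

import Mathlib

/-- `K` is an `f`-invariant subgroup of `H`, for a virtual endomorphism `f : H → G`:
`K ≤ H` and `f(K) ≤ K`. -/
def IsFInvariant {G : Type*} [Group G] {H : Subgroup G} (f : H →* G) (K : Subgroup G) : Prop :=
  K ≤ H ∧ ∀ h : H, (h : G) ∈ K → f h ∈ K

/-- The `f`-core of `H`: the largest subgroup of `H` that is normal in `G` and `f`-invariant
(see `isGreatest_fCore`). -/
def fCore {G : Type*} [Group G] {H : Subgroup G} (f : H →* G) : Subgroup G :=
  sSup {K : Subgroup G | K.Normal ∧ IsFInvariant f K}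

/-- The supremum in the definition of the `f`-core is attained. -/
theorem isGreatest_fCore {G : Type*} [Group G] {H : Subgroup G} (f : H →* G) :
    IsGreatest {K : Subgroup G | K.Normal ∧ IsFInvariant f K} (fCore f) := by
  refine ⟨⟨?_, ?_, ?_⟩, fun K hK => le_sSup hK⟩
  · refine ⟨fun x hx g => ?_⟩
    have key : fCore f ≤ (fCore f).comap (MulAut.conj g).toMonoidHom :=
      sSup_le fun K hK y hy => le_sSup hK (hK.1.conj_mem y hy g)
    exact key hx
  · exact sSup_le fun K hK => hK.2.1
  · have key : fCore f ≤ ((fCore f).comap f).map H.subtype := by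
      refine sSup_le fun K hK x hx => ?_
      exact ⟨⟨x, hK.2.1 hx⟩, le_sSup hK (hK.2.2 ⟨x, hK.2.1 hx⟩ hx), rfl⟩
    intro h hh
    obtain ⟨y, hy, hyh⟩ := key hh
    have : y = h := Subtype.ext hyh
    subst this
    exact hy

/-- The triple `(G, H, f)` is simple: the `f`-core of `H` is trivial. -/
def IsSimpleTriple {G : Type*} [Group G] {H : Subgroup G} (f : H →* G) : Prop :=
  fCore f = ⊥

/-- The (multiplicatively written) group `G` is a free abelian group. -/
def IsFreeAbelian.{u} (G : Type u) [Group G] : Prop :=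
  ∃ ι : Type u, Nonempty (G ≃* Multiplicative (FreeAbelianGroup ι))

/-- The derived length of a solvable group. -/
noncomputable def derivedLength (G : Type*) [Group G] : ℕ :=
  sInf {k : ℕ | derivedSeries G k = ⊥}

/-! A subgroup `H` of prime index in a nilpotent group is normal, and simplicity kills every normal
`f`-invariant subgroup found inside it. If the torsion subgroup lies in `H`, it is such a subgroup,
so `G` is torsion-free. The centre then escapes `H` (`IsSimpleTriple.not_center_le`), so `G = Z(G)H`
and `[G,G] = [H,H]` is `f`-invariant, hence trivial; `G` is free abelian. Otherwise some element of
`p`-power order lies outside `H`. Its normal closure `N` has bounded exponent and `G = NH`, so for a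
suitable power `m` of `p` the `m`-th powers of `G` are those of `H`. They generate an `f`-invariant
subgroup, so `G` has exponent dividing `m` and, being finitely generated, is finite. Examples come
from iterated wreath products of the cyclic group of order `p`: `H` is the base group, and `f` reads
one coordinate and embeds it back as tree automorphisms of the upper levels. -/

/-! ### Powers, commutators and torsion in nilpotent groups. -/

section NilpotentGroups

open scoped commutatorElement

variable {G : Type*} [Group G]

/-- The central elements of `G` whose `n`-th power lies in the subgroup `L`. -/
def centralRoots (L : Subgroup G) (n : ℕ) : Subgroup G where
  carrier := {z | z ∈ Subgroup.center G ∧ z ^ n ∈ L}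
  one_mem' := ⟨one_mem _, by simp [L.one_mem]⟩
  mul_mem' := by
    rintro a b ⟨ha, ha'⟩ ⟨hb, hb'⟩
    refine ⟨mul_mem ha hb, ?_⟩
    have hab : Commute a b := (Subgroup.mem_center_iff.mp ha b).symm
    rw [hab.mul_pow]
    exact mul_mem ha' hb'
  inv_mem' := by
    rintro a ⟨ha, ha'⟩
    exact ⟨inv_mem ha, by rw [inv_pow]; exact inv_mem ha'⟩

theorem mem_centralRoots {L : Subgroup G} {n : ℕ} {z : G} :
    z ∈ centralRoots L n ↔ z ∈ Subgroup.center G ∧ z ^ n ∈ L := Iff.rfl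

theorem commutatorElement_pow_left {a g : G} (h : ⁅a, g⁆ ∈ Subgroup.center G) (n : ℕ) :
    ⁅a ^ n, g⁆ = ⁅a, g⁆ ^ n := by
  induction n with
  | zero => simp
  | succ n ih =>
    have hc := Subgroup.mem_center_iff.mp h
    have h1 : ⁅a ^ (n + 1), g⁆ = a ^ n * ⁅a, g⁆ * (g * (a ^ n)⁻¹ * g⁻¹) := by
      rw [pow_succ]; simp only [commutatorElement_def]; group
    rw [h1, hc (a ^ n), pow_succ', ← ih]
    simp only [commutatorElement_def]; group

theorem commutatorElement_pow_right {a g : G} (h : ⁅a, g⁆ ∈ Subgroup.center G) (n : ℕ) :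
    ⁅a, g ^ n⁆ = ⁅a, g⁆ ^ n := by
  have h' : ⁅g, a⁆ ∈ Subgroup.center G := by
    rw [← commutatorElement_inv]; exact inv_mem h
  rw [← commutatorElement_inv, commutatorElement_pow_left h', ← commutatorElement_inv, inv_pow,
    inv_inv]

theorem commutatorElement_mul_left_of_mem_center {u : G} (hu : u ∈ Subgroup.center G) (z h : G) :
    ⁅z * u, h⁆ = ⁅z, h⁆ := by
  have hcu := Subgroup.mem_center_iff.mp hu h
  rw [commutatorElement_def, mul_assoc z, ← hcu, commutatorElement_def]
  group

theorem map_mk_lowerCentralSeries_le_center (i : ℕ) :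
    ((⊤ : Subgroup G).lowerCentralSeries i).map
      (QuotientGroup.mk' ((⊤ : Subgroup G).lowerCentralSeries (i + 1))) ≤ Subgroup.center _ := by
  rintro _ ⟨x, hx, rfl⟩
  rw [Subgroup.mem_center_iff]
  intro g
  obtain ⟨g, rfl⟩ := QuotientGroup.mk'_surjective _ g
  have hm : ⁅x, g⁆ ∈ (⊤ : Subgroup G).lowerCentralSeries (i + 1) := by
    rw [Subgroup.lowerCentralSeries_succ]
    exact Subgroup.commutator_mem_commutator hx (Subgroup.mem_top g)
  have := (QuotientGroup.eq_one_iff (N := (⊤ : Subgroup G).lowerCentralSeries (i + 1)) _).mpr hm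
  have h2 : ⁅QuotientGroup.mk' ((⊤ : Subgroup G).lowerCentralSeries (i + 1)) x,
    QuotientGroup.mk' ((⊤ : Subgroup G).lowerCentralSeries (i + 1)) g⁆ = 1 := by
    rw [← map_commutatorElement]; exact this
  exact (commutatorElement_eq_one_iff_mul_comm.mp h2).symm

/-- Modulo the term after `⁅y, g⁆`, that commutator is central and `⁅y, g⁆ ^ n = ⁅y ^ n, g⁆`, which
vanishes because `y ^ n` has become central. -/
theorem pow_mem_lowerCentralSeries_succ {n : ℕ} (hn : ∀ x : G, x ^ n ∈ commutator G) (i : ℕ) :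
    ∀ x ∈ (⊤ : Subgroup G).lowerCentralSeries i,
      x ^ n ∈ (⊤ : Subgroup G).lowerCentralSeries (i + 1) := by
  induction i with
  | zero =>
    intro x _
    rw [zero_add, Subgroup.top_lowerCentralSeries_one]
    exact hn x
  | succ i ih =>
    set N := (⊤ : Subgroup G).lowerCentralSeries (i + 2) with hN
    have hc := map_mk_lowerCentralSeries_le_center (G := G) (i + 1)
    have key : (⊤ : Subgroup G).lowerCentralSeries (i + 1) ≤
        (centralRoots (⊥ : Subgroup (G ⧸ N)) n).comap (QuotientGroup.mk' N) := by
      rw [Subgroup.lowerCentralSeries_succ, Subgroup.commutator_le]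
      intro y hy g hg
      have hyg : ⁅y, g⁆ ∈ (⊤ : Subgroup G).lowerCentralSeries (i + 1) := by
        rw [Subgroup.lowerCentralSeries_succ]
        exact Subgroup.commutator_mem_commutator hy hg
      have hcen := hc (Subgroup.mem_map_of_mem _ hyg)
      refine mem_centralRoots.mpr ⟨hcen, ?_⟩
      rw [Subgroup.mem_bot]
      have hpow := hc (Subgroup.mem_map_of_mem _ (ih y hy))
      rw [map_commutatorElement] at hcen ⊢
      rw [← commutatorElement_pow_left hcen, ← map_pow, commutatorElement_eq_one_iff_mul_comm]
      exact (Subgroup.mem_center_iff.mp hpow _).symm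
    intro x hx
    have := (mem_centralRoots.mp (key hx)).2
    rw [Subgroup.mem_bot, ← map_pow] at this
    exact (QuotientGroup.eq_one_iff _).mp this

/-- If every `n`-th power of an element of `G` lies in `H`, then some power map sends each term of
the lower central series of `G` to the corresponding term for `H`, modulo the next term. -/
theorem exists_pow_mem_lowerCentralSeries_sup {H : Subgroup G} {n : ℕ} (hn0 : 0 < n)
    (hn : ∀ x : G, x ^ n ∈ H) (i : ℕ) :
    ∃ k, 0 < k ∧ ∀ x ∈ (⊤ : Subgroup G).lowerCentralSeries i,
      x ^ k ∈ H.lowerCentralSeries i ⊔ (⊤ : Subgroup G).lowerCentralSeries (i + 1) := by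
  induction i with
  | zero => exact ⟨n, hn0, fun x _ => Subgroup.mem_sup_left (hn x)⟩
  | succ i ih =>
    obtain ⟨k, hk, ih⟩ := ih
    set N := (⊤ : Subgroup G).lowerCentralSeries (i + 2) with hN
    have hc := map_mk_lowerCentralSeries_le_center (G := G) (i + 1)
    have key : (⊤ : Subgroup G).lowerCentralSeries (i + 1) ≤
        (centralRoots ((H.lowerCentralSeries (i + 1)).map (QuotientGroup.mk' N))
          (k * n)).comap (QuotientGroup.mk' N) := by
      conv_lhs => rw [Subgroup.lowerCentralSeries_succ]
      rw [Subgroup.commutator_le]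
      intro y hy g hg
      have hyg : ∀ w, ⁅y, w⁆ ∈ (⊤ : Subgroup G).lowerCentralSeries (i + 1) := by
        intro w
        rw [Subgroup.lowerCentralSeries_succ]
        exact Subgroup.commutator_mem_commutator hy (Subgroup.mem_top w)
      have hcen := hc (Subgroup.mem_map_of_mem _ (hyg g))
      have hcen' := hc (Subgroup.mem_map_of_mem _ (hyg (g ^ n)))
      refine mem_centralRoots.mpr ⟨hcen, ?_⟩
      obtain ⟨z, hz, u, hu, hzu⟩ := Subgroup.mem_sup_of_normal_right.mp (ih y hy)
      have hu' := hc (Subgroup.mem_map_of_mem _ hu)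
      -- Modulo `N`: `⁅y, g⁆ ^ (k * n) = ⁅y ^ k, g ^ n⁆ = ⁅z, g ^ n⁆`, with both entries of the last
      -- commutator coming from `H`.
      rw [map_commutatorElement] at hcen hcen' ⊢
      rw [mul_comm, pow_mul, ← commutatorElement_pow_right hcen, ← map_pow,
        ← commutatorElement_pow_left hcen', ← map_pow, ← hzu]
      have h1 : ⁅QuotientGroup.mk' N (z * u), QuotientGroup.mk' N (g ^ n)⁆ =
          QuotientGroup.mk' N ⁅z, g ^ n⁆ := by
        rw [map_mul, commutatorElement_mul_left_of_mem_center hu', map_commutatorElement]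
      rw [h1]
      refine Subgroup.mem_map_of_mem _ ?_
      rw [Subgroup.lowerCentralSeries_succ]
      exact Subgroup.commutator_mem_commutator hz (hn g)
    refine ⟨k * n, Nat.mul_pos hk hn0, fun x hx => ?_⟩
    obtain ⟨z, hz, hzx⟩ := (mem_centralRoots.mp (key hx)).2
    rw [← map_pow, QuotientGroup.mk'_eq_mk'] at hzx
    obtain ⟨w, hw, hzw⟩ := hzx
    rw [← hzw]
    exact mul_mem (Subgroup.mem_sup_left hz) (Subgroup.mem_sup_right hw)

/-- Modulo `N ⊓ Z_i` the elements `t` and `h` commute, so `(t * h) ^ q = t' * h ^ q` with `t'` one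
step lower in the upper central series; then induct. -/
theorem mul_pow_pow_eq_of_mem_upperCentralSeries {N : Subgroup G} [N.Normal] {q : ℕ}
    (hq : ∀ t ∈ N, t ^ q = 1) (i : ℕ) :
    ∀ t ∈ N, t ∈ Subgroup.upperCentralSeries G i → ∀ h : G, (t * h) ^ q ^ i = h ^ q ^ i := by
  induction i with
  | zero =>
    intro t _ ht h
    rw [Subgroup.upperCentralSeries_zero, Subgroup.mem_bot] at ht
    rw [ht, one_mul]
  | succ i ih =>
    intro t htN ht h
    set M := N ⊓ Subgroup.upperCentralSeries G i
    have hcomm : ⁅t, h⁆ ∈ M := by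
      refine ⟨?_, Subgroup.mem_upperCentralSeries_succ_iff.mp ht h⟩
      rw [commutatorElement_def, mul_assoc t, mul_assoc t]
      exact mul_mem htN (‹N.Normal›.conj_mem _ (inv_mem htN) h)
    have hc : Commute (QuotientGroup.mk' M t) (QuotientGroup.mk' M h) := by
      refine commutatorElement_eq_one_iff_mul_comm.mp ?_
      rw [← map_commutatorElement]
      exact (QuotientGroup.eq_one_iff _).mpr hcomm
    have hmem : (t * h) ^ q * (h ^ q)⁻¹ ∈ M := by
      rw [← QuotientGroup.eq_one_iff (N := M), ← QuotientGroup.mk'_apply]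
      rw [map_mul, map_inv, map_pow, map_pow, map_mul, hc.mul_pow, ← map_pow, hq t htN, map_one,
        one_mul, mul_inv_cancel]
    have := ih _ hmem.1 hmem.2 (h ^ q)
    rwa [inv_mul_cancel_right, ← pow_mul, ← pow_mul, ← pow_succ'] at this

variable [Group.IsNilpotent G]

theorem exists_pow_pow_eq_one_of_closure {S : Set G} (hS : Subgroup.closure S = ⊤) {n : ℕ}
    (hn : ∀ s ∈ S, s ^ n = 1) : ∃ k, ∀ x : G, x ^ n ^ k = 1 := by
  have hab : ∀ x : G, x ^ n ∈ commutator G := by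
    intro x
    rw [← Abelianization.ker_of, MonoidHom.mem_ker, map_pow]
    have hx : x ∈ Subgroup.closure S := hS ▸ Subgroup.mem_top x
    induction hx using Subgroup.closure_induction with
    | mem x hx => rw [← map_pow, hn x hx, map_one]
    | one => simp
    | mul x y _ _ hx hy => rw [map_mul, mul_pow, hx, hy, one_mul]
    | inv x _ hx => rw [map_inv, inv_pow, hx, inv_one]
  have hmem : ∀ i, ∀ x : G, x ^ n ^ i ∈ (⊤ : Subgroup G).lowerCentralSeries i := by
    intro i
    induction i with
    | zero => intro x; simp
    | succ i ih =>
      intro x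
      rw [pow_succ, pow_mul]
      exact pow_mem_lowerCentralSeries_succ hab i _ (ih x)
  refine ⟨Group.nilpotencyClass G, fun x => ?_⟩
  have := hmem (Group.nilpotencyClass G) x
  rwa [Subgroup.lowerCentralSeries_nilpotencyClass, Subgroup.mem_bot] at this

theorem exists_pow_pow_eq_one_of_mem_closure {S : Set G} {n : ℕ} (hn : ∀ s ∈ S, s ^ n = 1) :
    ∃ k, ∀ x ∈ Subgroup.closure S, x ^ n ^ k = 1 := by
  obtain ⟨k, hk⟩ := exists_pow_pow_eq_one_of_closure
    (Subgroup.closure_closure_coe_preimage (k := S))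
    (n := n) (fun s hs => Subtype.ext (by simpa using hn _ hs))
  exact ⟨k, fun x hx => by simpa using congrArg Subtype.val (hk ⟨x, hx⟩)⟩

/-- The elements of finite order of a nilpotent group form a subgroup. -/
def torsionOfNilpotent (G : Type*) [Group G] [Group.IsNilpotent G] : Subgroup G where
  carrier := {x | IsOfFinOrder x}
  one_mem' := IsOfFinOrder.one
  mul_mem' := by
    intro x y hx hy
    obtain ⟨k, hk⟩ := exists_pow_pow_eq_one_of_mem_closure (S := {x, y})
      (n := orderOf x * orderOf y) (by
        rintro s (rfl | rfl)
        · rw [pow_mul, pow_orderOf_eq_one, one_pow]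
        · rw [mul_comm, pow_mul, pow_orderOf_eq_one, one_pow])
    refine isOfFinOrder_iff_pow_eq_one.mpr ⟨_, ?_, hk (x * y) (mul_mem ?_ ?_)⟩
    · exact Nat.pow_pos (Nat.mul_pos hx.orderOf_pos hy.orderOf_pos)
    · exact Subgroup.subset_closure (by simp)
    · exact Subgroup.subset_closure (by simp)
  inv_mem' := fun hx => IsOfFinOrder.inv hx

/-- In a torsion-free nilpotent group the quotient by the centre is torsion-free. -/
theorem mem_center_of_pow_mem_center (htf : ∀ x : G, IsOfFinOrder x → x = 1) {x : G} {n : ℕ}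
    (hn : 0 < n) (hx : x ^ n ∈ Subgroup.center G) : x ∈ Subgroup.center G := by
  have key : ∀ i, ∀ y ∈ Subgroup.upperCentralSeries G i, Commute x y := by
    intro i
    induction i with
    | zero =>
      intro y hy
      rw [Subgroup.upperCentralSeries_zero, Subgroup.mem_bot] at hy
      rw [hy]
      exact Commute.one_right x
    | succ i ih =>
      intro y hy
      have hu : Commute x ⁅y, x⁆ := ih _ (Subgroup.mem_upperCentralSeries_succ_iff.mp hy x)
      -- Conjugating the central `x ^ n` by `y` changes nothing; as `⁅y, x⁆` commutes with `x`, this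
      -- forces `⁅y, x⁆ ^ n = 1`.
      have h1 : (⁅y, x⁆ * x) ^ n = x ^ n := by
        have h2 : ⁅y, x⁆ * x = y * x * y⁻¹ := by simp [commutatorElement_def]
        rw [h2, conj_pow, Subgroup.mem_center_iff.mp hx y, mul_inv_cancel_right]
      rw [hu.symm.mul_pow, mul_eq_right] at h1
      have h3 := htf _ (isOfFinOrder_iff_pow_eq_one.mpr ⟨n, hn, h1⟩)
      exact (commutatorElement_eq_one_iff_mul_comm.mp h3).symm
  rw [Subgroup.mem_center_iff]
  intro y
  refine (key (Group.nilpotencyClass G) y ?_).symm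
  rw [Subgroup.upperCentralSeries_nilpotencyClass]
  exact Subgroup.mem_top y

/-- Induction on central quotients: once `G / Z(G)` is finite, the centre has finite index, so it is
finitely generated, abelian and torsion. -/
theorem finite_of_fg_of_isMulTorsion (G : Type*) [Group G] [Group.IsNilpotent G] :
    Group.FG G → IsMulTorsion G → Finite G := by
  refine Group.nilpotent_center_quotient_ind
    (P := fun G _ _ => Group.FG G → IsMulTorsion G → Finite G) G ?_ ?_
  · intro G _ _ _ _
    infer_instance
  · intro G _ _ ih _ ht
    have hQ : Finite (G ⧸ Subgroup.center G) := by
      refine ih inferInstance fun g => ?_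
      obtain ⟨g, rfl⟩ := QuotientGroup.mk'_surjective _ g
      exact (QuotientGroup.mk' _).isOfFinOrder (ht g)
    have : (Subgroup.center G).FiniteIndex := Subgroup.finiteIndex_of_finite_quotient
    have hZ : Finite (Subgroup.center G) := by
      let _ : CommGroup (Subgroup.center G) :=
        { (inferInstance : Group (Subgroup.center G)) with
          mul_comm := fun a b => Subtype.ext (Subgroup.mem_center_iff.mp b.2 a) }
      refine CommGroup.finite_of_fg_isMulTorsion _ fun g => ?_
      exact Submonoid.isOfFinOrder_coe.mp (ht g)
    exact Finite.of_subgroup_quotient (Subgroup.center G)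

end NilpotentGroups

/-! ### The dichotomy: finite `p`-group or free abelian. -/

section Dichotomy

open scoped commutatorElement

variable {G : Type*} [Group G] {H : Subgroup G} {f : H →* G}

theorem IsSimpleTriple.eq_bot (hf : IsSimpleTriple f) {K : Subgroup G} (hK : K.Normal)
    (hKH : K ≤ H) (hfK : ∀ h : H, (h : G) ∈ K → f h ∈ K) : K = ⊥ :=
  le_bot_iff.mp (hf ▸ (isGreatest_fCore f).2 ⟨hK, hKH, hfK⟩)

theorem map_mem_lowerCentralSeries (f : H →* G) (i : ℕ) (h : H)
    (hh : (h : G) ∈ H.lowerCentralSeries i) : f h ∈ (⊤ : Subgroup G).lowerCentralSeries i := by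
  rw [← Subgroup.top_subtype_lowerCentralSeries] at hh
  obtain ⟨y, hy, hyh⟩ := hh
  obtain rfl : y = h := Subtype.ext hyh
  have h1 := Subgroup.map_lowerCentralSeries (S := (⊤ : Subgroup H)) f i
  exact Subgroup.lowerCentralSeries_mono i le_top (h1 ▸ Subgroup.mem_map_of_mem f hy)

theorem isCoatom_of_index_prime {p : ℕ} (hp : p.Prime) (hH : H.index = p) : IsCoatom H := by
  constructor
  · rintro rfl
    rw [Subgroup.index_top] at hH
    exact hp.one_lt.ne hH
  · intro K hK
    have h1 := Subgroup.relIndex_mul_index hK.le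
    rw [hH] at h1
    rcases (Nat.dvd_prime hp).mp (Dvd.intro_left _ h1) with h2 | h2
    · exact Subgroup.index_eq_one.mp h2
    · exfalso
      rw [h2] at h1
      have h3 : H.relIndex K = 1 := Nat.eq_of_mul_eq_mul_right hp.pos (by rw [h1, one_mul])
      exact hK.not_ge (Subgroup.relIndex_eq_one.mp h3)

/-- If `G = Z(G) H` then `G` is abelian. -/
theorem IsSimpleTriple.mul_comm_of_not_center_le (hf : IsSimpleTriple f) (hH : IsCoatom H)
    [H.Normal] (hZ : ¬ Subgroup.center G ≤ H) (a b : G) : a * b = b * a := by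
  have hsup : Subgroup.center G ⊔ H = ⊤ :=
    hH.2 _ (lt_of_le_of_ne le_sup_right fun h => hZ (h ▸ le_sup_left))
  have hcomm : commutator G ≤ ⁅H, H⁆ := by
    rw [commutator_def, Subgroup.commutator_le]
    intro x _ y _
    have hdec : ∀ x : G, ∃ h ∈ H, ∃ z ∈ Subgroup.center G, h * z = x := fun x => by
      rw [← Subgroup.mem_sup_of_normal_right, sup_comm, hsup]
      exact Subgroup.mem_top x
    obtain ⟨h, hh, z, hz, rfl⟩ := hdec x
    obtain ⟨h', hh', z', hz', rfl⟩ := hdec y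
    rw [commutatorElement_mul_left_of_mem_center hz, ← commutatorElement_inv,
      commutatorElement_mul_left_of_mem_center hz', commutatorElement_inv]
    exact Subgroup.commutator_mem_commutator hh hh'
  have hbot : ⁅H, H⁆ = ⊥ := by
    refine hf.eq_bot inferInstance (Subgroup.commutator_le_left H H) fun h hh => ?_
    refine hcomm ?_
    rw [← Subgroup.top_lowerCentralSeries_one]
    exact map_mem_lowerCentralSeries f 1 h hh
  have hab : ⁅a, b⁆ ∈ commutator G :=
    Subgroup.commutator_mem_commutator (Subgroup.mem_top a) (Subgroup.mem_top b)
  have := hcomm hab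
  rw [hbot, Subgroup.mem_bot] at this
  exact commutatorElement_eq_one_iff_mul_comm.mp this

theorem isFreeAbelian_of_mul_comm [Group.FG G] (hcomm : ∀ a b : G, a * b = b * a)
    (htf : ∀ x : G, IsOfFinOrder x → x = 1) : IsFreeAbelian G := by
  let _ : CommGroup G := { (inferInstance : Group G) with mul_comm := hcomm }
  have : IsMulTorsionFree G := IsMulTorsionFree.of_not_isOfFinOrder fun x hx h => hx (htf x h)
  have : Module.Finite ℤ (Additive G) := Module.Finite.iff_addGroup_fg.mpr inferInstance
  have : Module.Free ℤ (Additive G) := inferInstance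
  let e : Additive G ≃+ FreeAbelianGroup (Module.Free.ChooseBasisIndex ℤ (Additive G)) :=
    (Module.Free.chooseBasis ℤ (Additive G)).repr.toAddEquiv.trans
      (FreeAbelianGroup.equivFinsupp _).symm
  exact ⟨_, ⟨AddEquiv.toMultiplicativeRight e⟩⟩

theorem exists_notMem_pow_prime_pow_eq_one {p : ℕ} (hp : p.Prime) (hH : H.index = p) [H.Normal]
    {t : G} (ht : t ∉ H) (hfin : IsOfFinOrder t) : ∃ s ∉ H, ∃ k, s ^ p ^ k = 1 := by
  obtain ⟨k, m, hpm, hkm⟩ :=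
    Nat.exists_eq_pow_mul_and_not_dvd hfin.orderOf_pos.ne' p hp.ne_one
  -- `m` is the prime-to-`p` part of the order of `t`; since `t ^ p ∈ H`, Bézout would put `t` in
  -- `H` if `t ^ m` were there.
  refine ⟨t ^ m, fun htm => ht ?_, k, ?_⟩
  · have htp : t ^ p ∈ H := hH ▸ Subgroup.pow_index_mem H t
    have hcop : Nat.Coprime m p := ((Nat.Prime.coprime_iff_not_dvd hp).mpr hpm).symm
    have hgcd := Nat.gcd_eq_gcd_ab m p
    rw [hcop.gcd_eq_one] at hgcd
    rw [← zpow_one t, ← Nat.cast_one, hgcd, zpow_add, zpow_mul, zpow_mul, zpow_natCast,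
      zpow_natCast]
    exact mul_mem (zpow_mem htm _) (zpow_mem htp _)
  · rw [← pow_mul, mul_comm, ← hkm, pow_orderOf_eq_one]

variable [Group.IsNilpotent G]

/-- If `H` does not contain all solutions of `t ^ n = 1`, then `G` has exponent dividing a power of
`n`. -/
theorem IsSimpleTriple.exists_forall_pow_eq_one (hf : IsSimpleTriple f) (hH : IsCoatom H)
    [H.Normal] {t : G} (ht : t ∉ H) {n : ℕ} (htn : t ^ n = 1) :
    ∃ k, ∀ x : G, x ^ n ^ k = 1 := by
  set N := Subgroup.normalClosure {t} with hN
  obtain ⟨k, hk⟩ := exists_pow_pow_eq_one_of_mem_closure (S := Group.conjugatesOfSet {t})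
    (n := n) (by
      intro s hs
      obtain ⟨_, rfl, hc⟩ := Group.mem_conjugatesOfSet_iff.mp hs
      obtain ⟨g, rfl⟩ := isConj_iff.mp hc
      rw [conj_pow, htn, mul_one, mul_inv_cancel])
  have htN : t ∈ N := Subgroup.subset_normalClosure rfl
  have hsup : N ⊔ H = ⊤ := hH.2 _ (lt_of_le_of_ne le_sup_right fun h =>
    ht (h ▸ Subgroup.mem_sup_left htN))
  -- `n ^ k` kills `N`; raising it to the class makes `(s * h) ^ m = h ^ m` for all `s ∈ N`.
  set m := (n ^ k) ^ Group.nilpotencyClass G with hm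
  have hpow : ∀ g : G, ∃ h : H, g ^ m = (h : G) ^ m := by
    intro g
    have hg : g ∈ N ⊔ H := hsup ▸ Subgroup.mem_top g
    obtain ⟨s, hs, h, hh, rfl⟩ := Subgroup.mem_sup_of_normal_right.mp hg
    refine ⟨⟨h, hh⟩, mul_pow_pow_eq_of_mem_upperCentralSeries (N := N) hk _ s hs ?_ h⟩
    rw [Subgroup.upperCentralSeries_nilpotencyClass]
    exact Subgroup.mem_top s
  set V := Subgroup.closure (Set.range fun g : G => g ^ m) with hV
  -- `V` is also generated by the `m`-th powers of `H`, so it lies in `H` and `f` maps it into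
  -- itself.
  have hVmap : V = ((Subgroup.closure (Set.range fun h : H => h ^ m)).map H.subtype) := by
    rw [MonoidHom.map_closure, hV]
    congr 1
    ext x
    constructor
    · rintro ⟨g, rfl⟩
      obtain ⟨h, hh⟩ := hpow g
      exact ⟨h ^ m, ⟨h, rfl⟩, by simpa using hh.symm⟩
    · rintro ⟨_, ⟨h, rfl⟩, rfl⟩
      exact ⟨h, by simp⟩
  have hbot : V = ⊥ := by
    refine hf.eq_bot ?_ ?_ ?_
    · refine ⟨fun x hx g => ?_⟩
      have : V ≤ V.comap (MulAut.conj g).toMonoidHom := by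
        rw [hV, Subgroup.closure_le]
        rintro _ ⟨y, rfl⟩
        exact Subgroup.subset_closure ⟨g * y * g⁻¹, by simp [conj_pow]⟩
      exact this hx
    · rw [hVmap]
      exact Subgroup.map_subtype_le _
    · intro h hh
      rw [hVmap] at hh
      obtain ⟨y, hy, hyh⟩ := hh
      obtain rfl : y = h := Subtype.ext hyh
      have : Subgroup.closure (Set.range fun h : H => h ^ m) ≤ V.comap f := by
        rw [Subgroup.closure_le]
        rintro _ ⟨z, rfl⟩
        exact Subgroup.subset_closure ⟨f z, by simp⟩
      exact this hy
  refine ⟨k * Group.nilpotencyClass G, fun x => ?_⟩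
  have : x ^ m ∈ V := Subgroup.subset_closure ⟨x, rfl⟩
  rwa [hbot, Subgroup.mem_bot, hm, ← pow_mul] at this

theorem IsSimpleTriple.eq_one_of_isOfFinOrder (hf : IsSimpleTriple f)
    (hle : torsionOfNilpotent G ≤ H) (x : G) (hx : IsOfFinOrder x) : x = 1 := by
  have hbot : torsionOfNilpotent G = ⊥ := by
    refine hf.eq_bot ⟨fun x hx g => ?_⟩ hle fun h hh => ?_
    · exact (MulAut.conj g).toMonoidHom.isOfFinOrder hx
    · exact f.isOfFinOrder (Submonoid.isOfFinOrder_coe.mp hh)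
  have : x ∈ torsionOfNilpotent G := hx
  rwa [hbot, Subgroup.mem_bot] at this

/-- The isolator of the last nontrivial term of the lower central series cannot lie in `H`. -/
theorem IsSimpleTriple.not_center_le (hf : IsSimpleTriple f) [Nontrivial G] [H.Normal]
    [H.FiniteIndex] (htf : ∀ x : G, IsOfFinOrder x → x = 1) : ¬ Subgroup.center G ≤ H := by
  intro hZ
  obtain ⟨c, hc⟩ : ∃ c, Group.nilpotencyClass G = c + 1 := by
    refine Nat.exists_eq_succ_of_ne_zero fun h => ?_
    exact not_subsingleton G (Group.nilpotencyClass_zero_iff_subsingleton.mp h)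
  -- Indexing starts at 0, so in class `c + 1` the term `c` is the last nontrivial one.
  set L := (⊤ : Subgroup G).lowerCentralSeries c with hL
  have hLbot : (⊤ : Subgroup G).lowerCentralSeries (c + 1) = ⊥ := by
    rw [← hc, Subgroup.lowerCentralSeries_nilpotencyClass]
  have hLne : L ≠ ⊥ := by
    intro h
    have := Subgroup.lowerCentralSeries_eq_bot_iff_nilpotencyClass_le.mp h
    omega
  have hLcenter : L ≤ Subgroup.center G := by
    intro x hx
    rw [Subgroup.mem_center_iff]
    intro g
    have hm : ⁅x, g⁆ ∈ (⊤ : Subgroup G).lowerCentralSeries (c + 1) := by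
      rw [Subgroup.lowerCentralSeries_succ]
      exact Subgroup.commutator_mem_commutator hx (Subgroup.mem_top g)
    rw [hLbot, Subgroup.mem_bot] at hm
    exact (commutatorElement_eq_one_iff_mul_comm.mp hm).symm
  obtain ⟨k, hk, hkL⟩ := exists_pow_mem_lowerCentralSeries_sup (H := H)
    (Nat.pos_of_ne_zero Subgroup.FiniteIndex.index_ne_zero) (Subgroup.pow_index_mem H) c
  rw [hLbot, sup_bot_eq] at hkL
  have hcen : ∀ {x : G} {n : ℕ}, 0 < n → x ^ n ∈ L → x ∈ Subgroup.center G := fun hn hx =>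
    mem_center_of_pow_mem_center htf hn (hLcenter hx)
  let I : Subgroup G :=
    { carrier := {x | ∃ n, 0 < n ∧ x ^ n ∈ L}
      one_mem' := ⟨1, one_pos, by simp [L.one_mem]⟩
      mul_mem' := by
        rintro a b ⟨n, hn, ha⟩ ⟨m, hm, hb⟩
        refine ⟨n * m, Nat.mul_pos hn hm, ?_⟩
        have hab : Commute a b := (Subgroup.mem_center_iff.mp (hcen hn ha) b).symm
        rw [hab.mul_pow, pow_mul, mul_comm, pow_mul]
        exact mul_mem (pow_mem ha _) (pow_mem hb _)
      inv_mem' := by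
        rintro a ⟨n, hn, ha⟩
        exact ⟨n, hn, by rw [inv_pow]; exact inv_mem ha⟩ }
  have hI : I = ⊥ := by
    refine hf.eq_bot ⟨?_⟩ ?_ ?_
    · rintro x ⟨n, hn, hx⟩ g
      rw [Subgroup.mem_center_iff.mp (hcen hn hx) g, mul_inv_cancel_right]
      exact ⟨n, hn, hx⟩
    · rintro x ⟨n, hn, hx⟩
      exact hZ (hcen hn hx)
    -- The `k`-th power pushes `h ^ n` from `L` into the term `c` of the series of `H`, which `f`
    -- maps into `L`.
    · rintro h ⟨n, hn, hx⟩
      refine ⟨n * k, Nat.mul_pos hn hk, ?_⟩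
      rw [← map_pow]
      refine map_mem_lowerCentralSeries f c _ ?_
      rw [Subgroup.coe_pow, pow_mul]
      exact hkL _ hx
  refine hLne (le_bot_iff.mp (hI ▸ fun x hx => ?_))
  exact ⟨1, one_pos, by rwa [pow_one]⟩

theorem IsSimpleTriple.finite_isPGroup_or_isFreeAbelian (hf : IsSimpleTriple f) [Group.FG G]
    {p : ℕ} (hp : p.Prime) (hH : H.index = p) : (Finite G ∧ IsPGroup p G) ∨ IsFreeAbelian G := by
  have hco := isCoatom_of_index_prime hp hH
  have hnormal : H.Normal :=
    Subgroup.NormalizerCondition.normal_of_coatom H Group.normalizerCondition_of_isNilpotent hco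
  have hfi : H.FiniteIndex := ⟨by rw [hH]; exact hp.ne_zero⟩
  have hnt : Nontrivial G := by
    by_contra h
    rw [not_nontrivial_iff_subsingleton] at h
    exact hco.1 (Subsingleton.elim _ _)
  by_cases hle : torsionOfNilpotent G ≤ H
  · right
    have htf := hf.eq_one_of_isOfFinOrder hle
    exact isFreeAbelian_of_mul_comm (hf.mul_comm_of_not_center_le hco (hf.not_center_le htf)) htf
  · left
    obtain ⟨t, htor, ht⟩ := SetLike.not_le_iff_exists.mp hle
    obtain ⟨s, hs, n, hsn⟩ := exists_notMem_pow_prime_pow_eq_one hp hH ht htor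
    obtain ⟨k, hk⟩ := hf.exists_forall_pow_eq_one hco hs hsn
    have hpG : IsPGroup p G := fun g => ⟨n * k, by rw [pow_mul]; exact hk g⟩
    refine ⟨finite_of_fg_of_isMulTorsion G inferInstance fun g => ?_, hpG⟩
    exact isOfFinOrder_iff_pow_eq_one.mpr ⟨_, Nat.pow_pos (Nat.pow_pos hp.pos), hk g⟩

end Dichotomy

/-! ### Examples of unbounded derived length from iterated wreath products. -/

namespace RegularWreathProduct

open scoped commutatorElement

variable {D E Q : Type*} [Group D] [Group E] [Group Q]

/-- The evaluation at `1` of the elements of the base group. -/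
def baseEval (D Q : Type*) [Group D] [Group Q] : (rightHom : D ≀ᵣ Q →* Q).ker →* D where
  toFun x := x.1.left 1
  map_one' := rfl
  map_mul' x y := by
    have hx : x.1.right = 1 := x.2
    simp [hx]

theorem baseEval_apply (x : (rightHom : D ≀ᵣ Q →* Q).ker) : baseEval D Q x = x.1.left 1 := rfl

/-- The homomorphism of wreath products induced by a homomorphism of the bottom groups. -/
def mapLeft (φ : D →* E) : D ≀ᵣ Q →* E ≀ᵣ Q where
  toFun x := ⟨fun q => φ (x.left q), x.right⟩
  map_one' := by ext <;> simp
  map_mul' x y := by ext <;> simp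

theorem inl_conj_left (x : D ≀ᵣ Q) (q r : Q) :
    (inl q * x * (inl q)⁻¹).left r = x.left (q⁻¹ * r) := by
  simp

/-- The chain of level stabilisers in a wreath product, given the level stabilisers `L` of the
bottom group. -/
def level (Q : Type*) [Group Q] (L : ℕ → Subgroup D) : ℕ → Subgroup (D ≀ᵣ Q)
  | 0 => ⊤
  | m + 1 =>
    { carrier := {x | x.right = 1 ∧ ∀ q, x.left q ∈ L m}
      one_mem' := ⟨rfl, fun _ => (L m).one_mem⟩
      mul_mem' := by
        rintro a b ⟨ha, ha'⟩ ⟨hb, hb'⟩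
        exact ⟨by simp [ha, hb], fun q => mul_mem (ha' q) (hb' _)⟩
      inv_mem' := by
        rintro a ⟨ha, ha'⟩
        exact ⟨by simp [ha], fun q => inv_mem (ha' _)⟩ }

theorem level_eq_bot {L : ℕ → Subgroup D} {m : ℕ} (h : L m = ⊥) : level Q L (m + 1) = ⊥ := by
  rw [eq_bot_iff]
  rintro x ⟨hx, hx'⟩
  refine RegularWreathProduct.ext (funext fun q => ?_) hx
  have := hx' q
  rwa [h] at this

theorem mem_level_of_mapLeft_mem {L : ℕ → Subgroup D} {φ : D →* D ≀ᵣ Q}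
    (h : ∀ m x, φ x ∈ level Q L m → x ∈ L m) (m : ℕ) (x : D ≀ᵣ Q)
    (hx : mapLeft φ x ∈ level Q (level Q L) m) : x ∈ level Q L m := by
  cases m with
  | zero => exact Subgroup.mem_top x
  | succ m => exact ⟨hx.1, fun q => h m _ (hx.2 q)⟩

/-- The core sinks through all levels: conjugation by `Q` brings any coordinate of an element of `K`
to position `1`, and `f`-invariance puts the image of that coordinate under `φ` back in `K`. -/
theorem isSimpleTriple_comp_baseEval {L : ℕ → Subgroup D} {φ : D →* D ≀ᵣ Q}
    (h : ∀ m x, φ x ∈ level Q L m → x ∈ L m) {N : ℕ} (hN : L N = ⊥) :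
    IsSimpleTriple (φ.comp (baseEval D Q)) := by
  obtain ⟨⟨hnormal, hle, hinv⟩, -⟩ := isGreatest_fCore (φ.comp (baseEval D Q))
  set K := fCore (φ.comp (baseEval D Q))
  have key : ∀ m, K ≤ level Q L m := by
    intro m
    induction m with
    | zero => exact le_top
    | succ m ih =>
      intro x hx
      refine ⟨hle hx, fun q => ?_⟩
      have hy := hnormal.conj_mem x hx (inl q⁻¹)
      have := h m _ (ih (hinv ⟨_, hle hy⟩ hy))
      rw [baseEval_apply, inl_conj_left] at this
      simpa using this
  exact le_bot_iff.mp (level_eq_bot (Q := Q) hN ▸ key (N + 1))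

theorem index_ker_rightHom : (rightHom : D ≀ᵣ Q →* Q).ker.index = Nat.card Q := by
  rw [Subgroup.index_ker, MonoidHom.range_eq_top.mpr fun q => ⟨inl q, rfl⟩, Subgroup.card_top]

/-- Each wreathing lengthens the derived series: for `s ≠ 1`, the commutator of `s` with `a` placed
at `1` has coordinate `a` at `1`, so the commutator subgroup already projects onto `D`. -/
theorem derivedSeries_le_map_baseEval [Nontrivial Q] (k : ℕ) :
    derivedSeries D k ≤ ((derivedSeries (D ≀ᵣ Q) (k + 1)).subgroupOf rightHom.ker).map
      (baseEval D Q) := by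
  classical
  induction k with
  | zero =>
    intro a _
    obtain ⟨s, hs⟩ := exists_ne (1 : Q)
    let x : D ≀ᵣ Q := ⟨Pi.mulSingle 1 a, 1⟩
    have hright : ⁅x, (inl s : D ≀ᵣ Q)⁆.right = 1 := by
      simp [x, commutatorElement_def]
    refine ⟨⟨⁅x, inl s⁆, hright⟩, ?_, ?_⟩
    · refine Subgroup.mem_subgroupOf.mpr ?_
      rw [zero_add, derivedSeries_one]
      exact Subgroup.commutator_mem_commutator (Subgroup.mem_top x) (Subgroup.mem_top (inl s))
    · simp [baseEval_apply, x, commutatorElement_def, hs]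
  | succ k ih =>
    rw [derivedSeries_succ]
    refine (Subgroup.commutator_mono ih ih).trans ?_
    rw [← Subgroup.map_commutator]
    refine Subgroup.map_mono ?_
    rw [Subgroup.commutator_le]
    intro a ha b hb
    refine Subgroup.mem_subgroupOf.mpr ?_
    rw [derivedSeries_succ]
    exact Subgroup.commutator_mem_commutator (Subgroup.mem_subgroupOf.mp ha)
      (Subgroup.mem_subgroupOf.mp hb)

theorem succ_le_of_derivedSeries_eq_bot [Nontrivial Q] {n : ℕ}
    (hn : ∀ k, derivedSeries D k = ⊥ → n ≤ k) (k : ℕ) (hk : derivedSeries (D ≀ᵣ Q) k = ⊥) :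
    n + 1 ≤ k := by
  cases k with
  | zero =>
    exfalso
    obtain ⟨s, hs⟩ := exists_ne (1 : Q)
    have h1 : (inl s : D ≀ᵣ Q) ∈ derivedSeries (D ≀ᵣ Q) 0 := Subgroup.mem_top (inl s)
    rw [hk, Subgroup.mem_bot] at h1
    exact hs (congrArg RegularWreathProduct.right h1)
  | succ k =>
    refine Nat.succ_le_succ (hn k (le_bot_iff.mp ?_))
    refine (derivedSeries_le_map_baseEval (Q := Q) k).trans ?_
    rw [hk, Subgroup.bot_subgroupOf, Subgroup.map_bot]

theorem isPGroup {p : ℕ} [Fact p.Prime] [Finite D] [Finite Q] (hD : IsPGroup p D)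
    (hQ : IsPGroup p Q) : IsPGroup p (D ≀ᵣ Q) := by
  obtain ⟨a, ha⟩ := IsPGroup.iff_card.mp hD
  obtain ⟨b, hb⟩ := IsPGroup.iff_card.mp hQ
  refine IsPGroup.of_card (n := a * p ^ b + b) ?_
  rw [card, ha, hb, pow_add, pow_mul]

/-- The iterated wreath products of a finite `p`-group `Q`, with their embeddings as groups of
automorphisms of the upper levels of the tree and their level stabilisers. -/
theorem exists_tower {p : ℕ} [Fact p.Prime] {Q : Type} [Group Q] [Finite Q] [Nontrivial Q]
    (hQ : IsPGroup p Q) (n : ℕ) :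
    ∃ (A : Type) (_ : Group A) (φ : A →* A ≀ᵣ Q) (L : ℕ → Subgroup A),
      Finite A ∧ IsPGroup p A ∧ (∃ N, L N = ⊥) ∧ (∀ m x, φ x ∈ level Q L m → x ∈ L m) ∧
        ∀ k, derivedSeries A k = ⊥ → n ≤ k := by
  induction n with
  | zero =>
    -- In the trivial group `⊤ = ⊥`, so the constant chain already reaches `⊥`.
    exact ⟨PUnit, inferInstance, 1, fun _ => ⊤, inferInstance,
      fun x => ⟨0, Subsingleton.elim _ _⟩, ⟨0, Subsingleton.elim _ _⟩,
      fun _ x _ => Subgroup.mem_top x, fun k _ => Nat.zero_le k⟩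
  | succ n ih =>
    obtain ⟨A, _, φ, L, hfin, hA, ⟨N, hN⟩, hφ, hn⟩ := ih
    exact ⟨A ≀ᵣ Q, inferInstance, mapLeft φ, level Q L, inferInstance, isPGroup hA hQ,
      ⟨N + 1, level_eq_bot hN⟩, mem_level_of_mapLeft_mem hφ, succ_le_of_derivedSeries_eq_bot hn⟩

end RegularWreathProduct

theorem derivedLength_le_nilpotencyClass (G : Type*) [Group G] [Group.IsNilpotent G] :
    derivedLength G ≤ Group.nilpotencyClass G := by
  refine Nat.sInf_le (le_bot_iff.mp ?_)
  refine (Subgroup.derived_le_lower_central _).trans ?_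
  rw [Subgroup.lowerCentralSeries_nilpotencyClass]

theorem le_derivedLength {G : Type*} [Group G] [Group.IsSolvable G] {n : ℕ}
    (hn : ∀ k, derivedSeries G k = ⊥ → n ≤ k) : n ≤ derivedLength G :=
  -- Solvability makes the set nonempty; an empty infimum would default to 0.
  le_csInf Group.IsSolvable.solvable hn

theorem exists_isSimpleTriple_isPGroup {p : ℕ} (hp : p.Prime) (n : ℕ) :
    ∃ (G : Type) (_ : Group G) (_ : Group.IsNilpotent G) (H : Subgroup G) (f : H →* G),
      Finite G ∧ IsPGroup p G ∧ H.index = p ∧ IsSimpleTriple f ∧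
        n ≤ Group.nilpotencyClass G ∧ n ≤ derivedLength G := by
  have : Fact p.Prime := ⟨hp⟩
  have hcard : Nat.card (Multiplicative (ZMod p)) = p := by
    rw [Nat.card_congr Multiplicative.toAdd, Nat.card_zmod]
  have hQ : IsPGroup p (Multiplicative (ZMod p)) := IsPGroup.of_card (n := 1) (by rw [hcard, pow_one])
  obtain ⟨A, _, φ, L, hfin, hA, ⟨N, hN⟩, hφ, hn⟩ := RegularWreathProduct.exists_tower hQ n
  have hG := RegularWreathProduct.isPGroup hA hQ
  have hnil : Group.IsNilpotent (A ≀ᵣ Multiplicative (ZMod p)) := hG.isNilpotent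
  have hlen : n ≤ derivedLength (A ≀ᵣ Multiplicative (ZMod p)) := le_derivedLength fun k hk =>
    (Nat.le_succ n).trans (RegularWreathProduct.succ_le_of_derivedSeries_eq_bot hn k hk)
  exact ⟨_, _, hnil, _, _, inferInstance, hG,
    RegularWreathProduct.index_ker_rightHom.trans hcard,
    RegularWreathProduct.isSimpleTriple_comp_baseEval hφ hN,
    hlen.trans (derivedLength_le_nilpotencyClass _), hlen⟩

theorem corollary2 (p : ℕ) (hp : p.Prime) :
    -- the dichotomy
    (∀ (G : Type*) [Group G] [Group.FG G] [Group.IsNilpotent G] (H : Subgroup G) (f : H →* G),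
      H.index = p → IsSimpleTriple f →
        (Finite G ∧ IsPGroup p G) ∨ IsFreeAbelian G) ∧
    -- in the finite case neither the nilpotency class nor the derived length is bounded
    (∀ n : ℕ, ∃ (G : Type) (_ : Group G) (_ : Group.IsNilpotent G) (H : Subgroup G) (f : H →* G),
      Finite G ∧ IsPGroup p G ∧ H.index = p ∧ IsSimpleTriple f ∧
        n ≤ Group.nilpotencyClass G ∧ n ≤ derivedLength G) :=
  ⟨fun _ _ _ _ _ _ hH hf => hf.finite_isPGroup_or_isFreeAbelian hp hH,
    exists_isSimpleTriple_isPGroup hp⟩
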